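/- **Setting.** There are $d\ge 1$ arms with unknown mean rewards $\theta^\star\in\mathbb{R}^d$ and a fixed action set $\mathcal A_t\equiv[d]$. In each round $t=1,\dots,T$ the agent picks an arm $a_t\in[d]$ on the basis of the past (and possibly internal randomization). The feedback $\theta^\star_{a_t}+\epsilon_t$ is then observed (realized) if $x_t=1$ and is censored if $x_t=0$, where, given the past, $x_t$ is Bernoulli with parameter $p_{a_t}\in(0,1]$; the noises $\epsilon_t$ are i.i.d. sub-Gaussian with variance proxy $\sigma^2$, and $\epsilon_t$ is independent of the past and of $x_t$. Let $\Delta_a=\max_{\tilde a}\theta^\star_{\tilde a}-\theta^\star_a$, let $R(T)=\sum_{t=1}^T\Delta_{a_t}$ be the pseudo-regret, and let $N_a(t)=\sum_{l\le t}\mathbf 1\{a_l=a,\ x_l=1\}$. The UCB algorithm with horizon $T$ and regularization $\lambda>0$ plays in each round $t$ an arm $a_t$ (ties broken arbitrarily) that maximizes $$\hat\theta^\lambda_{t-1}(a)+\sqrt{\frac{6\sigma^2\log T}{\lambda+N_a(t-1)}}+\frac{\lambda\|\theta^\star\|_\infty}{\lambda+N_a(t-1)},\qquad \hat\theta^\lambda_{t}(a)=\frac{1}{N_a(t)+\lambda}\sum_{l\le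 t}(\theta^\star_{a_l}+\epsilon_l)\mathbf 1\{a_l=a,\ x_l=1\}.$$ **Proposition.** There is an absolute constant $C>0$ such that for all $d$, $\theta^\star$, $(p_a)_{a\in[d]}$, $\sigma\ge 0$ and every choice of regularizations $\lambda=\lambda_T>0$ with $\lambda_T=o(\log T)$ (for instance a fixed $\lambda>0$), there is a $T_0$, depending only on these data, such that for all $T\ge T_0$ the UCB algorithm with horizon $T$ and regularization $\lambda_T$ satisfies $$\mathbb{E}[R(T)]\ \le\ C\,\log(T)\sum_{a:\,\Delta_a>0}\frac{1}{p_a}\max\Big(\frac{\sigma^2}{\Delta_a},\ \Delta_a\Big).$$ -/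

import Mathlib

open MeasureTheory ProbabilityTheory
open scoped NNReal

noncomputable section

/-- The suboptimality gap `max_c θ c - θ b` of the arm `b`. -/
def banditGap {d : ℕ} (θ : Fin d → ℝ) (b : Fin d) : ℝ :=
  (⨆ c, θ c) - θ b

/-- A `T`-round multi-armed bandit with noisy, randomly censored feedback. Rounds are numbered
`0, …, T - 1`, and `ℱ t` is the information (including any internal randomization of the agent)
that is available when the action `a t` of round `t` is chosen. The noises `ε t` are i.i.d.
sub-Gaussian with variance proxy `σ²`; given the past, the feedback of round `t` is realized
(`x t = true`) with probability `p (a t)`, independently of the noise of that round. -/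
structure IsCensoredBandit {Ω : Type*} {mΩ : MeasurableSpace Ω} (μ : Measure Ω)
    (ℱ : Filtration ℕ mΩ) {d : ℕ} (p : Fin d → ℝ) (σ : ℝ≥0) (T : ℕ)
    (a : ℕ → Ω → Fin d) (x : ℕ → Ω → Bool) (ε : ℕ → Ω → ℝ) : Prop where
  action_measurable : ∀ t < T, Measurable[ℱ t] (a t)
  realized_measurable : ∀ t < T, Measurable[ℱ (t + 1)] (x t)
  noise_measurable : ∀ t < T, Measurable[ℱ (t + 1)] (ε t)
  noise_identDistrib : ∀ s < T, ∀ t < T, IdentDistrib (ε s) (ε t) μ μ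
  noise_subgaussian : ∀ t < T, HasSubgaussianMGF (ε t) (σ ^ 2) μ
  noise_indep : ∀ t < T,
    Indep (MeasurableSpace.comap (ε t) inferInstance)
      (ℱ t ⊔ MeasurableSpace.comap (x t) inferInstance) μ
  realized_prob : ∀ t < T,
    μ[fun ω => if x t ω = true then (1 : ℝ) else 0 | ℱ t] =ᵐ[μ] fun ω => p (a t ω)

variable {Ω : Type*} {d : ℕ}

/-- The number of realized (uncensored) plays of the arm `b` in the first `t` rounds. -/
def numRealized (a : ℕ → Ω → Fin d) (x : ℕ → Ω → Bool) (b : Fin d) (t : ℕ) (ω : Ω) : ℕ :=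
  ((Finset.range t).filter fun l => a l ω = b ∧ x l ω = true).card

/-- The regularized empirical mean of the arm `b` after the first `t` rounds, computed from the
realized feedbacks `θ (a l) + ε l`. -/
def regMean (θ : Fin d → ℝ) (lam : ℝ) (a : ℕ → Ω → Fin d) (x : ℕ → Ω → Bool) (ε : ℕ → Ω → ℝ)
    (b : Fin d) (t : ℕ) (ω : Ω) : ℝ :=
  (∑ l ∈ Finset.range t, if a l ω = b ∧ x l ω = true then θ (a l ω) + ε l ω else 0) /
    (numRealized a x b t ω + lam)

/-- The optimistic reward estimator used in round `t` (that is, after the rounds `0, …, t - 1`)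
by UCB with regularization `lam` and horizon `T`. The norm `‖θ‖` is the sup norm. -/
def ucbIndex (θ : Fin d → ℝ) (σ : ℝ≥0) (lam : ℝ) (T : ℕ) (a : ℕ → Ω → Fin d)
    (x : ℕ → Ω → Bool) (ε : ℕ → Ω → ℝ) (b : Fin d) (t : ℕ) (ω : Ω) : ℝ :=
  regMean θ lam a x ε b t ω
    + Real.sqrt (6 * (σ : ℝ) ^ 2 * Real.log T / (lam + numRealized a x b t ω))
    + lam * ‖θ‖ / (lam + numRealized a x b t ω)

/-- The actions `a` follow UCB with regularization `lam` over `T` rounds: each round plays an arm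
of maximal index, ties being broken arbitrarily. -/
def FollowsUCB (θ : Fin d → ℝ) (σ : ℝ≥0) (lam : ℝ) (T : ℕ) (a : ℕ → Ω → Fin d)
    (x : ℕ → Ω → Bool) (ε : ℕ → Ω → ℝ) : Prop :=
  ∀ t < T, ∀ ω, ∀ b, ucbIndex θ σ lam T a x ε b t ω ≤ ucbIndex θ σ lam T a x ε (a t ω) t ω

/-- The pseudo-regret `R(T)` of the actions `a`. -/
def pseudoRegret (θ : Fin d → ℝ) (a : ℕ → Ω → Fin d) (T : ℕ) (ω : Ω) : ℝ :=
  ∑ t ∈ Finset.range T, banditGap θ (a t ω)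

end

/-! Regret is the sum over suboptimal arms `b` of the gap `Δ` times the expected number of plays of
`b`; two facts bound that number.

Concentration: a noise is independent of the past and of its own censoring, so the realized noise
sum `S` and realized count `N` of an arm make `exp (η S - η² σ² N / 2)` a supermartingale
(`lintegral_expProc_le_one`). Markov's inequality and a union bound over the values of `N` show that
`S` leaves the confidence width with probability at most `1 / T²` (`measure_deviation_le`). Without
deviations, optimism lets `b` be played only while `N ≤ 96 σ² log T / Δ² + log T`
(`numRealized_le_of_ucbIndex_le`); the second term absorbs the regularization bias, as `lam = o(log
T)`.

Censoring: a play of `b` is realized with conditional probability `p b`, so at most `(m + 1) / p b`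
plays are expected while `N ≤ m` (`sum_measureReal_le`). This is the source of the factor `1 / p b`.
-/

/-- The sum of the realized noises of the arm `b` over the first `t` rounds. -/
noncomputable def noiseSum (a : ℕ → Ω → Fin d) (x : ℕ → Ω → Bool) (ε : ℕ → Ω → ℝ) (b : Fin d) (t : ℕ)
    (ω : Ω) : ℝ :=
  ∑ l ∈ Finset.range t, if a l ω = b ∧ x l ω = true then ε l ω else 0

theorem numRealized_eq_sum (a : ℕ → Ω → Fin d) (x : ℕ → Ω → Bool) (b : Fin d) (t : ℕ) (ω : Ω) :
    numRealized a x b t ω =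
      ∑ l ∈ Finset.range t, if a l ω = b ∧ x l ω = true then 1 else 0 :=
  Finset.card_filter _ _

theorem numRealized_succ (a : ℕ → Ω → Fin d) (x : ℕ → Ω → Bool) (b : Fin d) (t : ℕ) (ω : Ω) :
    numRealized a x b (t + 1) ω =
      numRealized a x b t ω + if a t ω = b ∧ x t ω = true then 1 else 0 := by
  rw [numRealized_eq_sum, numRealized_eq_sum, Finset.sum_range_succ]

theorem numRealized_le (a : ℕ → Ω → Fin d) (x : ℕ → Ω → Bool) (b : Fin d) (t : ℕ) (ω : Ω) :
    numRealized a x b t ω ≤ t :=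
  (Finset.card_filter_le _ _).trans (Finset.card_range t).le

theorem regMean_eq (θ : Fin d → ℝ) (lam : ℝ) (a : ℕ → Ω → Fin d) (x : ℕ → Ω → Bool)
    (ε : ℕ → Ω → ℝ) (b : Fin d) (t : ℕ) (ω : Ω) :
    regMean θ lam a x ε b t ω =
      (numRealized a x b t ω * θ b + noiseSum a x ε b t ω) / (numRealized a x b t ω + lam) := by
  unfold regMean
  congr 1
  rw [numRealized_eq_sum, noiseSum, Nat.cast_sum, Finset.sum_mul, ← Finset.sum_add_distrib]
  refine Finset.sum_congr rfl fun l _ => ?_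
  split_ifs with h
  · simp [h.1]
  · simp

/-! ### Concentration of the realized noises. -/

namespace IsCensoredBandit

variable {mΩ : MeasurableSpace Ω} {μ : Measure Ω} {ℱ : Filtration ℕ mΩ} {p : Fin d → ℝ} {σ : ℝ≥0}
  {T : ℕ} {a : ℕ → Ω → Fin d} {x : ℕ → Ω → Bool} {ε : ℕ → Ω → ℝ}

theorem measurableSet_realized (h : IsCensoredBandit μ ℱ p σ T a x ε) (b : Fin d) {l t : ℕ}
    (hl : l < T) (hlt : l < t) : MeasurableSet[ℱ t] {ω | a l ω = b ∧ x l ω = true} := by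
  have h1 : MeasurableSet[ℱ t] (a l ⁻¹' {b}) :=
    ℱ.mono hlt.le _ (h.action_measurable l hl (measurableSet_singleton b))
  have h2 : MeasurableSet[ℱ t] (x l ⁻¹' {true}) :=
    ℱ.mono hlt _ (h.realized_measurable l hl (measurableSet_singleton true))
  exact h1.inter h2

theorem measurable_numRealized (h : IsCensoredBandit μ ℱ p σ T a x ε) (b : Fin d) {t : ℕ}
    (ht : t ≤ T) : Measurable[ℱ t] (numRealized a x b t) := by
  simp_rw [funext (numRealized_eq_sum a x b t)]
  refine Finset.measurable_fun_sum _ fun l hl => ?_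
  have hl := Finset.mem_range.1 hl
  exact Measurable.ite (h.measurableSet_realized b (hl.trans_le ht) hl) measurable_const
    measurable_const

theorem measurable_noiseSum (h : IsCensoredBandit μ ℱ p σ T a x ε) (b : Fin d) {t : ℕ}
    (ht : t ≤ T) : Measurable[ℱ t] (noiseSum a x ε b t) := by
  unfold noiseSum
  refine Finset.measurable_fun_sum _ fun l hl => ?_
  have hl := Finset.mem_range.1 hl
  exact Measurable.ite (h.measurableSet_realized b (hl.trans_le ht) hl)
    ((h.noise_measurable l (hl.trans_le ht)).mono (ℱ.mono hl) le_rfl) measurable_const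

/-- The exponential process of the realized noises of an arm. -/
noncomputable def expProc (σ : ℝ≥0) (a : ℕ → Ω → Fin d) (x : ℕ → Ω → Bool) (ε : ℕ → Ω → ℝ) (b : Fin d)
    (η : ℝ) (t : ℕ) (ω : Ω) : ENNReal :=
  ENNReal.ofReal (Real.exp (η * noiseSum a x ε b t ω
    - η ^ 2 * (σ : ℝ) ^ 2 / 2 * numRealized a x b t ω))

theorem measurable_expProc (h : IsCensoredBandit μ ℱ p σ T a x ε) (b : Fin d) (η : ℝ) {t : ℕ}
    (ht : t ≤ T) : Measurable[ℱ t] (expProc σ a x ε b η t) := by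
  have h1 := h.measurable_numRealized b ht
  have h2 := h.measurable_noiseSum b ht
  unfold expProc
  refine ENNReal.measurable_ofReal.comp (Real.measurable_exp.comp ?_)
  exact (h2.const_mul _).sub ((measurable_from_top (f := fun n : ℕ => (n : ℝ))).comp h1
    |>.const_mul _)

theorem lintegral_exp_noise_le [IsProbabilityMeasure μ] (h : IsCensoredBandit μ ℱ p σ T a x ε)
    (η : ℝ) {t : ℕ} (ht : t < T) :
    ∫⁻ ω, ENNReal.ofReal (Real.exp (η * ε t ω - η ^ 2 * (σ : ℝ) ^ 2 / 2)) ∂μ ≤ 1 := by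
  have hs := h.noise_subgaussian t ht
  have hi := hs.integrable_exp_mul η
  have hm := hs.mgf_le η
  rw [← ofReal_integral_eq_lintegral_ofReal, ← ENNReal.ofReal_one]
  · refine ENNReal.ofReal_le_ofReal ?_
    simp_rw [Real.exp_sub, div_eq_mul_inv (Real.exp _)]
    rw [integral_mul_const, ← div_eq_mul_inv, div_le_one (Real.exp_pos _)]
    refine hm.trans (le_of_eq ?_)
    push_cast
    ring_nf
  · simp_rw [Real.exp_sub]
    exact hi.div_const _
  · exact Filter.Eventually.of_forall fun _ => (Real.exp_pos _).le

/-- Supermartingale property, by induction on the round; working with `lintegral` avoids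
integrability conditions. -/
theorem lintegral_expProc_le_one [IsProbabilityMeasure μ] (h : IsCensoredBandit μ ℱ p σ T a x ε)
    (b : Fin d) (η : ℝ) {t : ℕ} (ht : t ≤ T) : ∫⁻ ω, expProc σ a x ε b η t ω ∂μ ≤ 1 := by
  induction t with
  | zero => simp [expProc, noiseSum, numRealized]
  | succ t ih =>
    have htT : t < T := ht
    have hεm : Measurable (ε t) := (h.noise_measurable t htT).mono (ℱ.le _) le_rfl
    have hxm : Measurable (x t) := (h.realized_measurable t htT).mono (ℱ.le _) le_rfl
    set M := expProc σ a x ε b η t with hM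
    set A : Set Ω := {ω | a t ω = b ∧ x t ω = true} with hA
    set Y : Ω → ENNReal :=
      fun ω => ENNReal.ofReal (Real.exp (η * ε t ω - η ^ 2 * (σ : ℝ) ^ 2 / 2)) with hY
    have hGle : ℱ t ⊔ MeasurableSpace.comap (x t) inferInstance ≤ mΩ := sup_le (ℱ.le _) hxm.comap_le
    have hMG :
        Measurable[ℱ t ⊔ MeasurableSpace.comap (x t) inferInstance] M := (h.measurable_expProc b η htT.le).mono le_sup_left le_rfl
    have hAG :
        MeasurableSet[ℱ t ⊔ MeasurableSpace.comap (x t) inferInstance] A := by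
      have h1 :
          MeasurableSet[ℱ t ⊔ MeasurableSpace.comap (x t) inferInstance] (a t ⁻¹' {b}) :=
        le_sup_left (a := ℱ t) _ (h.action_measurable t htT (measurableSet_singleton b))
      have h2 :
          MeasurableSet[ℱ t ⊔ MeasurableSpace.comap (x t) inferInstance] (x t ⁻¹' {true}) :=
        le_sup_right (a := ℱ t) _ ⟨{true}, measurableSet_singleton true, rfl⟩
      exact h1.inter h2
    have hA' : MeasurableSet A := hGle _ hAG
    have hYε : Measurable[MeasurableSpace.comap (ε t) inferInstance] Y := by
      have : Measurable fun r : ℝ =>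
          ENNReal.ofReal (Real.exp (η * r - η ^ 2 * (σ : ℝ) ^ 2 / 2)) := by fun_prop
      exact this.comp (comap_measurable _)
    -- The process changes only on `A`, where it gains the factor `Y`. Since `A` and `M` are
    -- determined by the past and `x t`, `Y` is independent of them and has mean at most 1.
    have hstep : ∀ ω, expProc σ a x ε b η (t + 1) ω = A.indicator M ω * Y ω + Aᶜ.indicator M ω := by
      intro ω
      by_cases hω : a t ω = b ∧ x t ω = true
      · have : ω ∈ A := hω
        rw [Set.indicator_of_mem this, Set.indicator_of_notMem (by simpa),
          add_zero]
        simp only [hM, hY, expProc, noiseSum, numRealized_succ, Finset.sum_range_succ]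
        rw [if_pos hω, if_pos hω, ← ENNReal.ofReal_mul (Real.exp_pos _).le, ← Real.exp_add]
        push_cast
        ring_nf
      · have : ω ∉ A := hω
        rw [Set.indicator_of_notMem this, Set.indicator_of_mem (by simpa)]
        simp only [hM, expProc, noiseSum, numRealized_succ, Finset.sum_range_succ]
        rw [if_neg hω, if_neg hω]
        simp
    simp_rw [hstep]
    rw [lintegral_add_right _ ((hMG.mono hGle le_rfl).indicator hA'.compl),
      lintegral_mul_eq_lintegral_mul_lintegral_of_independent_measurableSpace hGle hεm.comap_le
        (h.noise_indep t htT).symm (hMG.indicator hAG) hYε]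
    calc _ ≤ (∫⁻ ω, A.indicator M ω ∂μ) * 1 + ∫⁻ ω, Aᶜ.indicator M ω ∂μ := by
          gcongr
          exact h.lintegral_exp_noise_le η htT
      _ = ∫⁻ ω, M ω ∂μ := by
          rw [mul_one, lintegral_indicator hA', lintegral_indicator hA'.compl,
            lintegral_add_compl _ hA']
      _ ≤ 1 := ih htT.le

theorem measure_expProc_le [IsProbabilityMeasure μ] (h : IsCensoredBandit μ ℱ p σ T a x ε)
    (b : Fin d) (η v : ℝ) {t : ℕ} (ht : t ≤ T) :
    μ {ω | v ≤ η * noiseSum a x ε b t ω - η ^ 2 * (σ : ℝ) ^ 2 / 2 * numRealized a x b t ω} ≤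
      ENNReal.ofReal (Real.exp (-v)) := by
  have hm : Measurable (expProc σ a x ε b η t) :=
    (h.measurable_expProc b η ht).mono (ℱ.le _) le_rfl
  have h1 := mul_meas_ge_le_lintegral (μ := μ) hm (ENNReal.ofReal (Real.exp v))
  have h2 := h1.trans (h.lintegral_expProc_le_one b η ht)
  have hv : ENNReal.ofReal (Real.exp v) ≠ 0 := by simp [Real.exp_pos]
  rw [Real.exp_neg, ENNReal.ofReal_inv_of_pos (Real.exp_pos v), ENNReal.le_inv_iff_mul_le,
    mul_comm]
  refine le_trans ?_ h2
  gcongr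
  rename_i ω
  intro hω
  exact ENNReal.ofReal_le_ofReal (Real.exp_le_exp.2 hω)

theorem noiseSum_ae_eq_zero [IsProbabilityMeasure μ] (h : IsCensoredBandit μ ℱ p 0 T a x ε)
    (b : Fin d) {t : ℕ} (ht : t ≤ T) : ∀ᵐ ω ∂μ, noiseSum a x ε b t ω = 0 := by
  have h0 : ∀ᵐ ω ∂μ, ∀ l ∈ Finset.range t, ε l ω = 0 := by
    rw [Filter.eventually_all_finset]
    intro l hl
    have := h.noise_subgaussian l ((Finset.mem_range.1 hl).trans_le ht)
    rw [zero_pow two_ne_zero] at this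
    exact this.ae_eq_zero_of_hasSubgaussianMGF_zero
  filter_upwards [h0] with ω hω
  refine Finset.sum_eq_zero fun l hl => ?_
  simp [hω l hl]

/-- A deviation of the realized noises of an arm beyond the confidence width is unlikely. -/
theorem measure_deviation_le [IsProbabilityMeasure μ] (h : IsCensoredBandit μ ℱ p σ T a x ε)
    (b : Fin d) {lam s : ℝ} (hlam : 0 < lam) (hs : s ^ 2 = 1) {t : ℕ} (ht : t < T) :
    μ.real {ω | Real.sqrt (6 * (σ : ℝ) ^ 2 * Real.log T / (lam + numRealized a x b t ω)) <
        s * noiseSum a x ε b t ω / (lam + numRealized a x b t ω)} ≤ 1 / (T : ℝ) ^ 2 := by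
  have hT : (0 : ℝ) < T := by exact_mod_cast (Nat.zero_le t).trans_lt ht
  set B := {ω | Real.sqrt (6 * (σ : ℝ) ^ 2 * Real.log T / (lam + numRealized a x b t ω)) <
        s * noiseSum a x ε b t ω / (lam + numRealized a x b t ω)} with hB
  set L := Real.log T with hL
  have hL0 : 0 ≤ L := Real.log_natCast_nonneg T
  -- The choice of `η` below divides by `σ`; for `σ = 0` the noise vanishes almost surely.
  rcases eq_or_ne σ 0 with rfl | hσ
  · have : μ B = 0 := by
      refine measure_mono_null (t := {ω | ¬ noiseSum a x ε b t ω = 0}) ?_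
        (ae_iff.1 (h.noiseSum_ae_eq_zero b ht.le))
      intro ω hω h0
      simp [hB, h0] at hω
    rw [measureReal_def, this]
    simp
  have hσ' : (0 : ℝ) < σ := by exact_mod_cast pos_iff_ne_zero.2 hσ
  -- Maximizer of `η S - η² σ² n / 2` at `s * S = √(6 σ² L n)`, with maximum `3 L`. The count is
  -- random while `η` must be deterministic, hence one `η` for each possible value `n`.
  let η : ℕ → ℝ := fun n => s * Real.sqrt (6 * L / ((σ : ℝ) ^ 2 * n))
  have hsub : B ⊆ ⋃ n ∈ Finset.Icc 1 t, {ω | 3 * L ≤ η n * noiseSum a x ε b t ω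
      - η n ^ 2 * (σ : ℝ) ^ 2 / 2 * numRealized a x b t ω} := by
    intro ω hω
    simp only [hB, Set.mem_ofPred_eq] at hω
    simp only [Set.mem_iUnion, Set.mem_ofPred_eq, Finset.mem_Icc]
    set n := numRealized a x b t ω with hn
    set S := noiseSum a x ε b t ω with hS
    -- With no realized play the noise sum is zero and cannot deviate.
    have hn0 : n ≠ 0 := by
      intro hn0
      have hS0 : S = 0 := by
        refine Finset.sum_eq_zero fun l hl => if_neg fun hlb => ?_
        have := Finset.card_eq_zero.1 hn0
        exact Finset.notMem_empty l (this ▸ Finset.mem_filter.2 ⟨hl, hlb⟩)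
      rw [hS0, mul_zero, zero_div] at hω
      exact absurd hω (Real.sqrt_nonneg _).not_gt
    have hn1 : (0 : ℝ) < n := by exact_mod_cast Nat.pos_of_ne_zero hn0
    refine ⟨n, ⟨Nat.pos_of_ne_zero hn0, numRealized_le a x b t ω⟩, ?_⟩
    set D := lam + n with hD
    have hD0 : 0 < D := by positivity
    set r := Real.sqrt (6 * L / ((σ : ℝ) ^ 2 * n)) with hr
    have hr2 : r ^ 2 = 6 * L / ((σ : ℝ) ^ 2 * n) := Real.sq_sqrt (by positivity)
    have hη2 : η n ^ 2 * (σ : ℝ) ^ 2 / 2 * n = 3 * L := by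
      simp only [η, mul_pow, hs, ← hr, hr2]
      field_simp
      ring
    -- Clearing the denominator turns the width into `√(6 σ² L D)`, and `D ≥ n`: regularization only
    -- helps.
    have hS1 : Real.sqrt (6 * (σ : ℝ) ^ 2 * L * n) ≤ s * S := by
      rw [lt_div_iff₀ hD0] at hω
      refine le_trans ?_ hω.le
      refine Real.sqrt_le_iff.2 ⟨by positivity, ?_⟩
      rw [mul_pow, Real.sq_sqrt (by positivity)]
      have : 6 * (σ : ℝ) ^ 2 * L / D * D ^ 2 = 6 * (σ : ℝ) ^ 2 * L * D := by
        field_simp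
      rw [this]
      gcongr
      simp [hD, hlam.le]
    have h6 : 6 * L ≤ η n * S := by
      have e : r * Real.sqrt (6 * (σ : ℝ) ^ 2 * L * n) = 6 * L := by
        rw [hr, ← Real.sqrt_mul (by positivity)]
        rw [Real.sqrt_eq_iff_mul_self_eq (by positivity) (by positivity)]
        field_simp
      calc 6 * L = r * Real.sqrt (6 * (σ : ℝ) ^ 2 * L * n) := e.symm
        _ ≤ r * (s * S) := by gcongr
        _ = η n * S := by simp only [η, ← hr]; ring
    linarith
  have h3 : Real.exp (-(3 * L)) = 1 / (T : ℝ) ^ 3 := by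
    rw [Real.exp_neg, mul_comm, Real.exp_mul, hL, Real.exp_log hT, one_div]
    norm_cast
  calc μ.real B ≤ ∑ n ∈ Finset.Icc 1 t, μ.real {ω | 3 * L ≤ η n * noiseSum a x ε b t ω
      - η n ^ 2 * (σ : ℝ) ^ 2 / 2 * numRealized a x b t ω} :=
        (measureReal_mono hsub (measure_ne_top _ _)).trans (measureReal_biUnion_finset_le _ _)
    _ ≤ ∑ n ∈ Finset.Icc 1 t, 1 / (T : ℝ) ^ 3 := by
        refine Finset.sum_le_sum fun n _ => ?_
        rw [← h3]
        exact ENNReal.toReal_le_of_le_ofReal (Real.exp_pos _).le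
          (h.measure_expProc_le b (η n) (3 * L) ht.le)
    _ = t / (T : ℝ) ^ 3 := by simp [div_eq_mul_inv]
    _ ≤ T / (T : ℝ) ^ 3 := by gcongr
    _ = 1 / (T : ℝ) ^ 2 := by field_simp

end IsCensoredBandit

/-! ### Deterministic counting and optimism. -/

/-- Each counted round raises the realized count by one from a value at most `m`. The bound by the
count itself, inside the `min`, is what carries the induction. -/
theorem sum_realized_of_numRealized_le (a : ℕ → Ω → Fin d) (x : ℕ → Ω → Bool) (b : Fin d)
    (m k : ℕ) (ω : Ω) :
    (∑ t ∈ Finset.range k,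
      if (a t ω = b ∧ numRealized a x b t ω ≤ m) ∧ x t ω = true then 1 else 0) ≤
      min (numRealized a x b k ω) (m + 1) := by
  induction k with
  | zero => simp
  | succ k ih =>
    rw [Finset.sum_range_succ, numRealized_succ]
    rw [le_min_iff] at ih ⊢
    split_ifs <;> grind

theorem banditGap_nonneg (θ : Fin d → ℝ) (b : Fin d) : 0 ≤ banditGap θ b :=
  sub_nonneg.2 (le_ciSup (Set.finite_range θ).bddAbove b)

/-- A suboptimal arm that maximizes the index while no noise deviates has few realized plays. -/
theorem numRealized_le_of_ucbIndex_le {θ : Fin d → ℝ} {σ : ℝ≥0} {lam : ℝ} {T : ℕ}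
    {a : ℕ → Ω → Fin d} {x : ℕ → Ω → Bool} {ε : ℕ → Ω → ℝ} {b c : Fin d} {t : ℕ} {ω : Ω}
    (hlam : 0 < lam) (hc : θ c = ⨆ i, θ i) (hb : 0 < banditGap θ b)
    (hsmall : 4 * (lam * ‖θ‖) ≤ Real.log T * banditGap θ b)
    (hidx : ucbIndex θ σ lam T a x ε c t ω ≤ ucbIndex θ σ lam T a x ε b t ω)
    (hdc : (-1) * noiseSum a x ε c t ω / (lam + numRealized a x c t ω) ≤
      Real.sqrt (6 * (σ : ℝ) ^ 2 * Real.log T / (lam + numRealized a x c t ω)))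
    (hdb : 1 * noiseSum a x ε b t ω / (lam + numRealized a x b t ω) ≤
      Real.sqrt (6 * (σ : ℝ) ^ 2 * Real.log T / (lam + numRealized a x b t ω))) :
    (numRealized a x b t ω : ℝ) ≤
      96 * (σ : ℝ) ^ 2 * Real.log T / banditGap θ b ^ 2 + Real.log T := by
  have hmean : ∀ i, regMean θ lam a x ε i t ω = θ i
      + noiseSum a x ε i t ω / (lam + numRealized a x i t ω)
      - lam * θ i / (lam + numRealized a x i t ω) := by
    intro i
    have : lam + (numRealized a x i t ω : ℝ) ≠ 0 := by positivity
    rw [regMean_eq, add_comm (numRealized a x i t ω : ℝ) lam]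
    field_simp
    ring
  have hθ : ∀ i, |θ i| ≤ ‖θ‖ := fun i => norm_le_pi_norm θ i
  have hL0 : 0 ≤ Real.log T := Real.log_natCast_nonneg T
  unfold ucbIndex at hidx
  rw [hmean, hmean] at hidx
  rw [neg_one_mul, neg_div] at hdc
  rw [one_mul] at hdb
  set N := (numRealized a x b t ω : ℝ)
  set L := Real.log T
  set Δ := banditGap θ b with hΔ
  set w := Real.sqrt (6 * (σ : ℝ) ^ 2 * L / (lam + N)) with hw
  have hN0 : 0 ≤ N := Nat.cast_nonneg _
  have hD : 0 < lam + N := by positivity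
  have h1 : lam * θ c / (lam + numRealized a x c t ω) ≤
      lam * ‖θ‖ / (lam + numRealized a x c t ω) := by
    gcongr
    exact (le_abs_self _).trans (hθ c)
  have h2 : -(lam * θ b / (lam + N)) ≤ lam * ‖θ‖ / (lam + N) := by
    rw [← neg_div, ← mul_neg]
    gcongr
    exact (neg_le_abs _).trans (hθ b)
  have hΔc : Δ = θ c - θ b := by rw [hΔ, banditGap, hc]
  -- The index of `c` is at least `θ c`, and that of `b` is at most `θ b` plus twice the width and
  -- twice the bias bound.
  have hmain : Δ ≤ 2 * w + 2 * (lam * ‖θ‖ / (lam + N)) := by linarith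
  have hpos : 0 ≤ 96 * (σ : ℝ) ^ 2 * L / Δ ^ 2 := by positivity
  -- One of the two terms is at least `Δ / 2`: the width gives `96 = 6 * 4²`, the bias is handled by
  -- `hsmall`.
  rcases le_total (Δ / 2) (2 * w) with h | h
  · have h4 : (Δ / 4) ^ 2 ≤ 6 * (σ : ℝ) ^ 2 * L / (lam + N) := by
      rw [← Real.sq_sqrt (show 0 ≤ 6 * (σ : ℝ) ^ 2 * L / (lam + N) by positivity), ← hw]
      gcongr
      linarith
    rw [le_div_iff₀ hD] at h4
    have : lam + N ≤ 96 * (σ : ℝ) ^ 2 * L / Δ ^ 2 := by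
      rw [le_div_iff₀ (by positivity)]
      linarith
    linarith
  · have h4 : Δ / 4 ≤ lam * ‖θ‖ / (lam + N) := by linarith
    rw [le_div_iff₀ hD] at h4
    have : lam + N ≤ L := by
      refine le_of_mul_le_mul_right ?_ hb
      linarith
    linarith

/-! ### From realized plays to expected plays and regret. -/

namespace IsCensoredBandit

variable {mΩ : MeasurableSpace Ω} {μ : Measure Ω} {ℱ : Filtration ℕ mΩ} {p : Fin d → ℝ} {σ : ℝ≥0}
  {T : ℕ} {a : ℕ → Ω → Fin d} {x : ℕ → Ω → Bool} {ε : ℕ → Ω → ℝ}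

/-- `E` is decided before `x t`, and on it the conditional realization probability is the constant
`p b`. -/
theorem prob_mul_measureReal [IsProbabilityMeasure μ] (h : IsCensoredBandit μ ℱ p σ T a x ε)
    (b : Fin d) {t : ℕ} (ht : t < T) {E : Set Ω} (hE : MeasurableSet[ℱ t] E)
    (hEb : ∀ ω ∈ E, a t ω = b) :
    p b * μ.real E = μ.real (E ∩ {ω | x t ω = true}) := by
  have hE' : MeasurableSet E := ℱ.le _ _ hE
  have hxm : Measurable (x t) := (h.realized_measurable t ht).mono (ℱ.le _) le_rfl
  have hx : MeasurableSet {ω | x t ω = true} := hxm (measurableSet_singleton true)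
  have hind : (fun ω => if x t ω = true then (1 : ℝ) else 0) =
      Set.indicator {ω | x t ω = true} 1 := by
    ext ω
    simp [Set.indicator_apply]
  have hint : Integrable (fun ω => if x t ω = true then (1 : ℝ) else 0) μ := by
    rw [hind]
    exact (integrable_const (1 : ℝ)).indicator hx
  have h1 := setIntegral_condExp (ℱ.le t) hint hE
  rw [setIntegral_congr_ae hE' ((h.realized_prob t ht).mono fun ω hω hωE =>
    hω.trans (congrArg p (hEb ω hωE))), setIntegral_const, smul_eq_mul, mul_comm] at h1
  rw [h1, hind, integral_indicator_one hx, measureReal_restrict_apply hx, Set.inter_comm]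

/-- Multiplying by `p b` replaces plays by realized plays, of which at most `m + 1` start with a
count at most `m` on every path. -/
theorem sum_measureReal_le [IsProbabilityMeasure μ] (h : IsCensoredBandit μ ℱ p σ T a x ε)
    (b : Fin d) (m : ℕ) :
    p b * ∑ t ∈ Finset.range T, μ.real {ω | a t ω = b ∧ numRealized a x b t ω ≤ m} ≤ m + 1 := by
  have hE : ∀ t < T, MeasurableSet[ℱ t] {ω | a t ω = b ∧ numRealized a x b t ω ≤ m} := by
    intro t ht
    have h1 : MeasurableSet[ℱ t] (a t ⁻¹' {b}) :=
      h.action_measurable t ht (measurableSet_singleton b)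
    have h2 : MeasurableSet[ℱ t] (numRealized a x b t ⁻¹' Set.Iic m) :=
      h.measurable_numRealized b ht.le measurableSet_Iic
    exact h1.inter h2
  have hF : ∀ t < T, MeasurableSet
      ({ω | a t ω = b ∧ numRealized a x b t ω ≤ m} ∩ {ω | x t ω = true}) := by
    intro t ht
    have h1 : MeasurableSet (x t ⁻¹' {true}) :=
      ℱ.le _ _ (h.realized_measurable t ht (measurableSet_singleton true))
    exact (ℱ.le _ _ (hE t ht)).inter h1
  rw [Finset.mul_sum]
  calc _ = ∑ t ∈ Finset.range T,
        ∫ ω, ({ω | a t ω = b ∧ numRealized a x b t ω ≤ m} ∩ {ω | x t ω = true}).indicator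
          (1 : Ω → ℝ) ω ∂μ := by
        refine Finset.sum_congr rfl fun t ht => ?_
        have ht := Finset.mem_range.1 ht
        rw [h.prob_mul_measureReal b ht (hE t ht) (fun ω hω => hω.1),
          integral_indicator_one (hF t ht)]
    _ = ∫ ω, ∑ t ∈ Finset.range T,
        ({ω | a t ω = b ∧ numRealized a x b t ω ≤ m} ∩ {ω | x t ω = true}).indicator
          (1 : Ω → ℝ) ω ∂μ := by
        rw [integral_finsetSum]
        exact fun t ht => (integrable_const (1 : ℝ)).indicator (hF t (Finset.mem_range.1 ht))
    _ ≤ ∫ ω, ((m : ℝ) + 1) ∂μ := by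
        refine integral_mono (integrable_finsetSum _ fun t ht =>
          (integrable_const (1 : ℝ)).indicator (hF t (Finset.mem_range.1 ht)))
          (integrable_const _) fun ω => ?_
        have := (sum_realized_of_numRealized_le a x b m T ω).trans (min_le_right _ _)
        simp only [Set.indicator_apply, Set.mem_inter_iff, Set.mem_ofPred_eq, Pi.one_apply]
        exact_mod_cast this
    _ = m + 1 := by simp

/-- The expected number of plays of a suboptimal arm under UCB. -/
theorem sum_measureReal_action_le [IsProbabilityMeasure μ]
    (h : IsCensoredBandit μ ℱ p σ T a x ε) {θ : Fin d → ℝ} {lam : ℝ}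
    (hU : FollowsUCB θ σ lam T a x ε) {b c : Fin d} (hlam : 0 < lam) (hp : 0 < p b)
    (hT : 0 < T) (hc : θ c = ⨆ i, θ i) (hb : 0 < banditGap θ b)
    (hsmall : 4 * (lam * ‖θ‖) ≤ Real.log T * banditGap θ b) :
    ∑ t ∈ Finset.range T, μ.real {ω | a t ω = b} ≤
      (96 * (σ : ℝ) ^ 2 * Real.log T / banditGap θ b ^ 2 + Real.log T + 1) / p b + 2 / T := by
  have hT' : (0 : ℝ) < T := by exact_mod_cast hT
  set K := 96 * (σ : ℝ) ^ 2 * Real.log T / banditGap θ b ^ 2 + Real.log T with hK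
  have hL0 : 0 ≤ Real.log T := Real.log_natCast_nonneg T
  have hK0 : 0 ≤ K := by positivity
  have hstep : ∀ t ∈ Finset.range T, μ.real {ω | a t ω = b} ≤
      μ.real {ω | a t ω = b ∧ numRealized a x b t ω ≤ ⌊K⌋₊} + 2 / (T : ℝ) ^ 2 := by
    intro t ht
    have ht := Finset.mem_range.1 ht
    have hBc := h.measure_deviation_le c hlam (s := -1) (by norm_num) ht
    have hBb := h.measure_deviation_le b hlam (s := 1) (by norm_num) ht
    set Bc := {ω | Real.sqrt (6 * (σ : ℝ) ^ 2 * Real.log T / (lam + numRealized a x c t ω)) <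
        (-1) * noiseSum a x ε c t ω / (lam + numRealized a x c t ω)}
    set Bb := {ω | Real.sqrt (6 * (σ : ℝ) ^ 2 * Real.log T / (lam + numRealized a x b t ω)) <
        1 * noiseSum a x ε b t ω / (lam + numRealized a x b t ω)}
    have hsub : {ω | a t ω = b} ⊆
        {ω | a t ω = b ∧ numRealized a x b t ω ≤ ⌊K⌋₊} ∪ (Bc ∪ Bb) := by
      intro ω hω
      by_cases hωc : ω ∈ Bc
      · exact Or.inr (Or.inl hωc)
      by_cases hωb : ω ∈ Bb
      · exact Or.inr (Or.inr hωb)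
      have hω' : a t ω = b := hω
      refine Or.inl ⟨hω', Nat.le_floor ?_⟩
      exact numRealized_le_of_ucbIndex_le hlam hc hb hsmall (hω' ▸ hU t ht ω c)
        (not_lt.1 hωc) (not_lt.1 hωb)
    have h1 := measureReal_mono (μ := μ) hsub (measure_ne_top _ _)
    have h2 := measureReal_union_le (μ := μ)
      {ω | a t ω = b ∧ numRealized a x b t ω ≤ ⌊K⌋₊} (Bc ∪ Bb)
    have h3 := measureReal_union_le (μ := μ) Bc Bb
    have h4 : 2 / (T : ℝ) ^ 2 = 1 / (T : ℝ) ^ 2 + 1 / (T : ℝ) ^ 2 := by ring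
    linarith
  refine (Finset.sum_le_sum hstep).trans ?_
  rw [Finset.sum_add_distrib, Finset.sum_const, Finset.card_range, nsmul_eq_mul]
  have h5 : (T : ℝ) * (2 / (T : ℝ) ^ 2) = 2 / T := by field_simp
  rw [h5]
  gcongr
  rw [le_div_iff₀ hp, mul_comm]
  refine (h.sum_measureReal_le b ⌊K⌋₊).trans ?_
  gcongr
  exact Nat.floor_le hK0

theorem integral_pseudoRegret [IsProbabilityMeasure μ] (h : IsCensoredBandit μ ℱ p σ T a x ε)
    (θ : Fin d → ℝ) :
    ∫ ω, pseudoRegret θ a T ω ∂μ =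
      ∑ b with 0 < banditGap θ b,
        banditGap θ b * ∑ t ∈ Finset.range T, μ.real {ω | a t ω = b} := by
  have hm : ∀ t ∈ Finset.range T, ∀ b, MeasurableSet {ω | a t ω = b} := fun t ht b =>
    ℱ.le _ _ (h.action_measurable t (Finset.mem_range.1 ht) (measurableSet_singleton b))
  have hreg : ∀ ω, pseudoRegret θ a T ω = ∑ t ∈ Finset.range T, ∑ b,
      banditGap θ b * Set.indicator {ω | a t ω = b} (1 : Ω → ℝ) ω := by
    intro ω
    refine Finset.sum_congr rfl fun t _ => ?_
    simp [Set.indicator_apply]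
  have hint : ∀ t ∈ Finset.range T, ∀ b, Integrable
      (fun ω => banditGap θ b * Set.indicator {ω | a t ω = b} (1 : Ω → ℝ) ω) μ := fun t ht b =>
    ((integrable_const (1 : ℝ)).indicator (hm t ht b)).const_mul _
  simp_rw [hreg]
  rw [integral_finsetSum _ fun t ht => integrable_finsetSum _ fun b _ => hint t ht b]
  -- Arms of zero gap contribute nothing.
  rw [Finset.sum_filter_of_ne fun b _ hb =>
    (banditGap_nonneg θ b).lt_of_ne' (left_ne_zero_of_mul hb)]
  simp_rw [Finset.mul_sum]
  rw [Finset.sum_comm]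
  refine Finset.sum_congr rfl fun t ht => ?_
  rw [integral_finsetSum _ fun b _ => hint t ht b]
  refine Finset.sum_congr rfl fun b _ => ?_
  rw [integral_const_mul, integral_indicator_one (hm t ht b)]

end IsCensoredBandit

/-! ### Choice of the threshold and assembly. -/

/-- The constant `C` is absolute; the threshold `T₀` depends only on the arms, their mean rewards,
the realization probabilities, the variance proxy and the regularization schedule. -/
theorem mainTheorem6 :
    ∃ C : ℝ, 0 < C ∧
      ∀ (d : ℕ) (θ p : Fin d → ℝ) (σ : ℝ≥0) (lam : ℕ → ℝ),
        0 < d →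
        (∀ b, 0 < p b ∧ p b ≤ 1) →
        (∀ T, 0 < lam T) →
        (lam =o[Filter.atTop] fun T : ℕ => Real.log (T : ℝ)) →
        ∃ T₀ : ℕ, ∀ T : ℕ, T₀ ≤ T →
          ∀ (Ω : Type*) (mΩ : MeasurableSpace Ω) (μ : Measure Ω) (_ : IsProbabilityMeasure μ)
            (ℱ : Filtration ℕ mΩ) (a : ℕ → Ω → Fin d) (x : ℕ → Ω → Bool) (ε : ℕ → Ω → ℝ),
            IsCensoredBandit μ ℱ p σ T a x ε →
            FollowsUCB θ σ (lam T) T a x ε →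
            ∫ ω, pseudoRegret θ a T ω ∂μ ≤
              C * (Real.log T *
                ∑ b with 0 < banditGap θ b,
                  1 / p b * max ((σ : ℝ) ^ 2 / banditGap θ b) (banditGap θ b)) := by
  refine ⟨100, by norm_num, ?_⟩
  intro d θ p σ lam hd hp hlam hlog
  have : Nonempty (Fin d) := ⟨⟨0, hd⟩⟩
  obtain ⟨c, hc⟩ := exists_eq_ciSup_of_finite (f := θ)
  have hev : ∀ᶠ T : ℕ in Filter.atTop, ∀ b, 0 < banditGap θ b →
      4 * (lam T * ‖θ‖) ≤ Real.log T * banditGap θ b := by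
    rw [Filter.eventually_all]
    intro b
    by_cases hb : 0 < banditGap θ b
    -- The `+ 1` keeps the denominator positive when `θ = 0`.
    · have hc0 : 0 < banditGap θ b / (4 * (‖θ‖ + 1)) := by positivity
      filter_upwards [hlog.def hc0] with T hT _
      rw [Real.norm_of_nonneg (hlam T).le,
        Real.norm_of_nonneg (Real.log_natCast_nonneg T)] at hT
      calc 4 * (lam T * ‖θ‖) ≤ 4 * (‖θ‖ + 1) * lam T := by nlinarith [hlam T]
        _ ≤ 4 * (‖θ‖ + 1) * (banditGap θ b / (4 * (‖θ‖ + 1)) * Real.log T) := by gcongr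
        _ = Real.log T * banditGap θ b := by field_simp
    · exact Filter.Eventually.of_forall fun T h => absurd h hb
  obtain ⟨T₁, hT₁⟩ := Filter.eventually_atTop.1 hev
  -- `3 > e` gives `log T ≥ 1`, which absorbs the additive constants.
  refine ⟨max T₁ 3, ?_⟩
  intro T hT Ω mΩ μ _ ℱ a x ε h hU
  have hT3 : 3 ≤ T := (le_max_right _ _).trans hT
  have hT3' : (3 : ℝ) ≤ T := by exact_mod_cast hT3
  have hL : 1 ≤ Real.log T := by
    rw [Real.le_log_iff_exp_le (by linarith)]
    exact Real.exp_one_lt_three.le.trans hT3'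
  rw [h.integral_pseudoRegret θ, Finset.mul_sum, Finset.mul_sum]
  refine Finset.sum_le_sum fun b hb => ?_
  have hb : 0 < banditGap θ b := (Finset.mem_filter.1 hb).2
  have hpb := (hp b).1
  have hcount := h.sum_measureReal_action_le hU (hlam T) hpb (by omega) hc hb
    (hT₁ T ((le_max_left _ _).trans hT) b hb)
  set Δ := banditGap θ b
  set L := Real.log T
  have hm1 := le_max_left ((σ : ℝ) ^ 2 / Δ) Δ
  have hm2 := le_max_right ((σ : ℝ) ^ 2 / Δ) Δ
  set M := max ((σ : ℝ) ^ 2 / Δ) Δ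
  calc _ ≤ Δ * ((96 * (σ : ℝ) ^ 2 * L / Δ ^ 2 + L + 1) / p b + 2 / T) := by gcongr
    -- Uses `1 ≤ L` and `p b ≤ 1 ≤ T`. The terms `L + L + 2 * L` yield the 4 in `100 = 96 + 4`.
    _ ≤ Δ * ((96 * (σ : ℝ) ^ 2 * L / Δ ^ 2 + L + L) / p b + 2 * L / p b) := by
        gcongr
        · linarith
        · linarith [(hp b).2]
    _ = L / p b * (96 * ((σ : ℝ) ^ 2 / Δ) + 4 * Δ) := by field_simp; ring
    _ ≤ L / p b * (96 * M + 4 * M) := by gcongr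
    _ = 100 * (L * (1 / p b * M)) := by ring
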